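/- Let $K$ be an algebraically closed field and let $\Lambda=K\langle\alpha,\beta\rangle/(\alpha^2,\ \alpha\beta+\beta\alpha,\ \beta^2)$ be the exterior algebra in two variables over $K$. Modules are finitely generated left $\Lambda$-modules. For an integer $n\ge 0$ let $S_{-n}$ be the $\Lambda$-module with underlying vector space $K^{n}\oplus K^{n+1}$ on which $$\alpha\cdot(x,y)=\big((y_1,\dots,y_n),0\big),\qquad \beta\cdot(x,y)=\big((y_2,\dots,y_{n+1}),0\big)\qquad (x\in K^n,\ y\in K^{n+1}).$$ (Thus $S_0$ is the simple module and $S_{-1}\cong\operatorname{rad}\Lambda$.) For any positive integers $n$ and $k$ there exists a short exact sequence of $\Lambda$-modules $$0\to S_{-(n+k+1)}^{\,k}\to S_{-(n+k)}^{\,k+1}\xrightarrow{\ f_{-(n+k)}\ } S_{-n}\to 0$$ in which the morphism $f_{-(n+k)}$ has the following property: if $X$ is an indecomposable $\Lambda$-module that is not isomorphic to $S_{-(n+i)}$ for any $i=0,\dots,k-1$, then every morphism $X\to S_{-n}$ factors through $f_{-(n+k)}$. -/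

import Mathlib

/-- The exterior algebra in two variables `α = ι e₀`, `β = ι e₁` over `K`, that is,
`K⟨α, β⟩ / (α², αβ + βα, β²)`. -/
abbrev Lam (K : Type*) [Field K] : Type _ := ExteriorAlgebra K (Fin 2 → K)

/-- The underlying space `K^{2n+1} = K^n × K^{n+1}` of the module `S_{-n}`. -/
def SNeg (K : Type*) (n : ℕ) : Type _ := (Fin n → K) × (Fin (n + 1) → K)

namespace SNeg

variable (K : Type*) [Field K] (n : ℕ)

instance : AddCommGroup (SNeg K n) :=
  inferInstanceAs (AddCommGroup ((Fin n → K) × (Fin (n + 1) → K)))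

instance : Module K (SNeg K n) :=
  inferInstanceAs (Module K ((Fin n → K) × (Fin (n + 1) → K)))

/-- The map `(x, y) ↦ ((y₁, …, yₙ), 0)`, given by the block matrix with rows
`(0 | Iₙ | 0)` and `0`. -/
def hα : Module.End K (SNeg K n) where
  toFun z := ((fun i => z.2 i.castSucc, 0) : (Fin n → K) × (Fin (n + 1) → K))
  map_add' _ _ := Prod.ext rfl (add_zero (0 : Fin (n + 1) → K)).symm
  map_smul' c _ := Prod.ext rfl (smul_zero c : c • (0 : Fin (n + 1) → K) = 0).symm

/-- The map `(x, y) ↦ ((y₂, …, yₙ₊₁), 0)`, given by the block matrix with rows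
`(0 | 0 | Iₙ)` and `0`. -/
def hβ : Module.End K (SNeg K n) where
  toFun z := ((fun i => z.2 i.succ, 0) : (Fin n → K) × (Fin (n + 1) → K))
  map_add' _ _ := Prod.ext rfl (add_zero (0 : Fin (n + 1) → K)).symm
  map_smul' c _ := Prod.ext rfl (smul_zero c : c • (0 : Fin (n + 1) → K) = 0).symm

/-- The linear map `K² → End_K(S_{-n})` that sends `e₀` to `hα` and `e₁` to `hβ`. -/
def act : (Fin 2 → K) →ₗ[K] Module.End K (SNeg K n) :=
  (LinearMap.proj 0).smulRight (hα K n) + (LinearMap.proj 1).smulRight (hβ K n)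

theorem act_mul_act (v : Fin 2 → K) : act K n v * act K n v = 0 := by
  have h1 : hα K n * hα K n = 0 := rfl
  have h2 : hα K n * hβ K n = 0 := rfl
  have h3 : hβ K n * hα K n = 0 := rfl
  have h4 : hβ K n * hβ K n = 0 := rfl
  simp [act, mul_add, add_mul, h1, h2, h3, h4]

/-- The representation of the exterior algebra on `K^{2n+1}` in which `α` acts by `hα` and
`β` by `hβ`. -/
noncomputable def rep : Lam K →ₐ[K] Module.End K (SNeg K n) :=
  ExteriorAlgebra.lift K ⟨act K n, act_mul_act K n⟩

noncomputable instance : Module (Lam K) (SNeg K n) :=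
  Module.compHom (SNeg K n) (rep K n).toRingHom

end SNeg

/-- A module is indecomposable if it is nonzero and is not the direct sum of two nonzero
submodules. -/
def IsIndecomposableModule (R M : Type*) [Ring R] [AddCommGroup M] [Module R M] : Prop :=
  Nontrivial M ∧ ∀ N P : Submodule R M, IsCompl N P → N = ⊥ ∨ P = ⊥

/-!
The components of `f : S_{-(n+k)}^{k+1} → S_{-n}` are the `k + 1` possible `window` maps, which
select consecutive coordinates; the kernel inclusion `g` is `windowDiff`, whose entries are
differences of the two windows `S_{-(m+1)} → S_{-m}`. The composite telescopes, `g` is injective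
because its kernel consists of families of shifted sequences (`eq_zero_of_shift`), and exactness
in the middle is a dimension count.

For the factorization property, composing windows reduces the claim to `k = 1` by induction
(`exists_windowSum_comp_eq`): if `X` is indecomposable and `X ≇ S_{-n}`, then every `φ : X → S_{-n}`
is the sum of the two windows of homomorphisms `X → S_{-(n+1)}`. For `n > 0`, a homomorphism to
`S_{-n}` is a chain of functionals `ξ_0, …, ξ_{n-1}` on `X` with `ξ_j β = ξ_{j+1} α` that vanish on
`αβX`, and the latter condition is automatic for chains of length at least two (`homOfChain`). So
the claim asks that a linear system for functionals on `X` be solvable. Its transpose is the map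
`pencil`, whose kernel is `Hom(S_{-n}, X)`; by linear duality (`exists_window_add_window`), the
system is solvable unless some `σ : S_{-n} → X` has a composite `φ ∘ σ` whose last top coordinate
does not kill the last basis vector of the top. In that case the matrix of `φ ∘ σ` on the top is a
nonzero scalar by a Toeplitz argument (`toeplitz_eq`), so `φ ∘ σ` is bijective, `φ` splits, and
indecomposability gives `X ≅ S_{-n}`.
-/

/-! ### Modules over the exterior algebra and the coordinates of `S_{-n}` -/

/-- The generator `α` of the exterior algebra in two variables. -/
noncomputable def Lam.α (K : Type*) [Field K] : Lam K := ExteriorAlgebra.ι K (Pi.single 0 1)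

/-- The generator `β` of the exterior algebra in two variables. -/
noncomputable def Lam.β (K : Type*) [Field K] : Lam K := ExteriorAlgebra.ι K (Pi.single 1 1)

namespace Lam

variable {K : Type*} [Field K]

theorem ι_eq (v : Fin 2 → K) : ExteriorAlgebra.ι K v = v 0 • α K + v 1 • β K := by
  rw [α, β, ← map_smul, ← map_smul, ← map_add]
  congr 1
  ext i
  fin_cases i <;> simp

section Action

variable {X : Type*} [AddCommGroup X] [Module (Lam K) X]

theorem α_smul_α_smul (x : X) : α K • α K • x = 0 := by
  rw [smul_smul, α, ExteriorAlgebra.ι_sq_zero, zero_smul]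

theorem β_smul_β_smul (x : X) : β K • β K • x = 0 := by
  rw [smul_smul, β, ExteriorAlgebra.ι_sq_zero, zero_smul]

theorem α_smul_β_smul (x : X) : α K • β K • x = -(β K • α K • x) := by
  rw [eq_neg_iff_add_eq_zero, smul_smul, smul_smul, ← add_smul, α, β,
    ExteriorAlgebra.ι_add_mul_swap, zero_smul]

variable {Y : Type*} [AddCommGroup Y] [Module (Lam K) Y]
  [Module K X] [IsScalarTower K (Lam K) X] [Module K Y] [IsScalarTower K (Lam K) Y]

/-- A `K`-linear map that commutes with `α` and `β` is linear over the exterior algebra. -/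
noncomputable def homOfCommutes (u : X →ₗ[K] Y) (hα : ∀ x, u (α K • x) = α K • u x)
    (hβ : ∀ x, u (β K • x) = β K • u x) : X →ₗ[Lam K] Y where
  toFun := u
  map_add' := u.map_add
  map_smul' a := by
    induction a using ExteriorAlgebra.induction with
    | algebraMap r => intro x; simp [algebraMap_smul]
    | ι v => intro x; simp [ι_eq, add_smul, smul_assoc, hα, hβ]
    | mul a b ha hb => intro x; simp_all [mul_smul]
    | add a b ha hb => intro x; simp_all [add_smul]

end Action

end Lam

namespace SNeg

open Lam

variable {K : Type*} [Field K] {n : ℕ}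

instance : IsScalarTower K (Lam K) (SNeg K n) :=
  .of_algebraMap_smul fun r x => by
    change rep K n (algebraMap K (Lam K) r) x = r • x
    rw [AlgHom.commutes, Module.algebraMap_end_apply]

instance : Module.Finite K (SNeg K n) :=
  inferInstanceAs (Module.Finite K ((Fin n → K) × (Fin (n + 1) → K)))

theorem finrank_eq : Module.finrank K (SNeg K n) = 2 * n + 1 := by
  change Module.finrank K ((Fin n → K) × (Fin (n + 1) → K)) = _
  rw [Module.finrank_prod, Module.finrank_fin_fun, Module.finrank_fin_fun]
  ring

variable (K n) in
/-- The first component `x` of an element `(x, y)` of `S_{-n}`; it parametrizes the socle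
(for `n > 0`). -/
def soc : SNeg K n →ₗ[K] (Fin n → K) := LinearMap.fst K (Fin n → K) (Fin (n + 1) → K)

variable (K n) in
/-- The second component `y` of an element `(x, y)` of `S_{-n}`; it parametrizes the top
(for `n > 0`). -/
def top : SNeg K n →ₗ[K] (Fin (n + 1) → K) := LinearMap.snd K (Fin n → K) (Fin (n + 1) → K)

/-- The element `(x, y)` of `S_{-n}`. -/
def mk (x : Fin n → K) (y : Fin (n + 1) → K) : SNeg K n := (x, y)

@[simp] theorem soc_mk (x : Fin n → K) (y : Fin (n + 1) → K) : soc K n (mk x y) = x := rfl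

@[simp] theorem top_mk (x : Fin n → K) (y : Fin (n + 1) → K) : top K n (mk x y) = y := rfl

theorem ext_coord {z w : SNeg K n} (hx : ∀ i, soc K n z i = soc K n w i)
    (hy : ∀ i, top K n z i = top K n w i) : z = w :=
  Prod.ext (funext hx) (funext hy)

theorem α_smul (z : SNeg K n) : α K • z = hα K n z := by
  change rep K n (ExteriorAlgebra.ι K _) z = _
  simp [rep, act]

theorem β_smul (z : SNeg K n) : β K • z = hβ K n z := by
  change rep K n (ExteriorAlgebra.ι K _) z = _
  simp [rep, act]

@[simp] theorem soc_α_smul (z : SNeg K n) (i : Fin n) :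
    soc K n (α K • z) i = top K n z i.castSucc := by rw [α_smul]; rfl

@[simp] theorem top_α_smul (z : SNeg K n) (i : Fin (n + 1)) :
    top K n (α K • z) i = 0 := by rw [α_smul]; rfl

@[simp] theorem soc_β_smul (z : SNeg K n) (i : Fin n) :
    soc K n (β K • z) i = top K n z i.succ := by rw [β_smul]; rfl

@[simp] theorem top_β_smul (z : SNeg K n) (i : Fin (n + 1)) :
    top K n (β K • z) i = 0 := by rw [β_smul]; rfl

/-! ### Homomorphisms into and out of `S_{-n}` -/

section Hom

variable {X : Type*} [AddCommGroup X] [Module (Lam K) X]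

/-- For `n > 0` a homomorphism into `S_{-n}` is determined by its socle coordinates. -/
theorem hom_ext {φ ψ : X →ₗ[Lam K] SNeg K (n + 1)}
    (h : ∀ i x, soc K (n + 1) (φ x) i = soc K (n + 1) (ψ x) i) : φ = ψ := by
  ext x
  refine ext_coord (fun i => h i x) fun i => ?_
  refine Fin.lastCases ?_ (fun j => ?_) i
  · rw [← Fin.succ_last, ← soc_β_smul, ← soc_β_smul, ← map_smul, ← map_smul, h]
  · rw [← soc_α_smul, ← soc_α_smul, ← map_smul, ← map_smul, h]

variable [Module K X] [IsScalarTower K (Lam K) X]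

/-- The homomorphism into `S_{-m}`, `m = n + 2`, with socle coordinates `s 0, …, s (m - 1)`,
where `s j ∘ β = s (j + 1) ∘ α` for all `j < m - 1`. Because `m ≥ 2`, these relations force all
`s j` to vanish on `αβX`. -/
noncomputable def homOfChain (s : Fin (n + 2) → X →ₗ[K] K)
    (hs : ∀ (j : Fin (n + 1)) x, s j.castSucc (β K • x) = s j.succ (α K • x)) :
    X →ₗ[Lam K] SNeg K (n + 2) :=
  have hβα : ∀ j x, s j (β K • α K • x) = 0 := fun j x => by
    refine Fin.lastCases ?_ (fun i => ?_) j
    · rw [← neg_neg (β K • α K • x), ← α_smul_β_smul, map_neg, ← Fin.succ_last, ← hs,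
        β_smul_β_smul, map_zero, neg_zero]
    · rw [hs, α_smul_α_smul, map_zero]
  have hαβ : ∀ j x, s j (α K • β K • x) = 0 := fun j x => by
    rw [α_smul_β_smul, map_neg, hβα, neg_zero]
  homOfCommutes (u :=
      { toFun := fun x => mk (fun j => s j x)
          (Fin.snoc (α := fun _ => K) (fun j => s j (α K • x)) (s (Fin.last _) (β K • x)))
        map_add' := fun x y => by
          refine ext_coord (fun i => by simp) fun i => ?_
          refine Fin.lastCases ?_ (fun j => ?_) i <;> simp
        map_smul' := fun c x => by
          refine ext_coord (fun i => by simp) fun i => ?_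
          refine Fin.lastCases ?_ (fun j => ?_) i <;> simp [smul_algebra_smul_comm] })
    (fun x => by
      refine ext_coord (fun i => by simp) fun i => ?_
      refine Fin.lastCases ?_ (fun j => ?_) i <;> simp [α_smul_α_smul, hβα])
    (fun x => by
      refine ext_coord (fun i => ?_) fun i => ?_
      · refine Fin.lastCases ?_ (fun j => ?_) i
        · simp
        · simp only [LinearMap.coe_mk, AddHom.coe_mk, soc_mk, soc_β_smul, top_mk]
          rw [Fin.succ_castSucc, Fin.snoc_castSucc, hs]
      · refine Fin.lastCases ?_ (fun j => ?_) i <;> simp [β_smul_β_smul, hαβ])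

/-- The homomorphism out of `S_{-n}` that sends the standard basis of the top to elements
`y 0, …, y n` with `β y₀ = 0`, `α y_j = β y_{j+1}`, `α y_n = 0`. -/
noncomputable def homOfTop (y : Fin (n + 1) → X) (h0 : β K • y 0 = 0)
    (h : ∀ j : Fin n, β K • y j.succ = α K • y j.castSucc)
    (h1 : α K • y (Fin.last n) = 0) : SNeg K n →ₗ[Lam K] X :=
  homOfCommutes (u :=
      { toFun := fun z => ∑ j, top K n z j • y j + ∑ j, soc K n z j • α K • y j.castSucc
        map_add' := fun z w => by simp [add_smul, Finset.sum_add_distrib]; abel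
        map_smul' := fun c z => by simp [mul_smul, Finset.smul_sum] })
    (fun z => by
      simp [Finset.smul_sum, smul_algebra_smul_comm, α_smul_α_smul, Fin.sum_univ_castSucc, h1])
    (fun z => by
      have : ∀ j : Fin n, β K • α K • y j.castSucc = 0 := fun j => by rw [← h, β_smul_β_smul]
      simp [Finset.smul_sum, smul_algebra_smul_comm, this, Fin.sum_univ_succ, h0, h])

theorem homOfTop_apply (y : Fin (n + 1) → X) (h0 : β K • y 0 = 0)
    (h : ∀ j : Fin n, β K • y j.succ = α K • y j.castSucc)
    (h1 : α K • y (Fin.last n) = 0) (z : SNeg K n) :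
    homOfTop y h0 h h1 z =
      ∑ j, top K n z j • y j + ∑ j, soc K n z j • α K • y j.castSucc := rfl

end Hom

/-! ### The maps `f` and `g` -/

/-- The epimorphism `S_{-(n+k)} → S_{-n}`, `0 ≤ i ≤ k`, that keeps the coordinates
`x_{i+1}, …, x_{i+n}` and `y_{i+1}, …, y_{i+n+1}`. -/
noncomputable def window (K : Type*) [Field K] (n k : ℕ) (i : Fin (k + 1)) :
    SNeg K (n + k) →ₗ[Lam K] SNeg K n :=
  homOfCommutes (u :=
      { toFun := fun z => mk (fun j => soc K (n + k) z ⟨j + i, by omega⟩)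
          (fun j => top K (n + k) z ⟨j + i, by omega⟩)
        map_add' := fun _ _ => rfl
        map_smul' := fun _ _ => rfl })
    (fun z => by
      refine ext_coord (fun j => ?_) fun j => ?_
      · change soc K (n + k) (α K • z) ⟨j + i, by omega⟩ = _
        rw [soc_α_smul, soc_α_smul]
        rfl
      · change top K (n + k) (α K • z) ⟨j + i, by omega⟩ = _
        rw [top_α_smul, top_α_smul])
    (fun z => by
      refine ext_coord (fun j => ?_) fun j => ?_
      · change soc K (n + k) (β K • z) ⟨j + i, by omega⟩ = _
        rw [soc_β_smul, soc_β_smul]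
        exact congrArg (top K (n + k) z) (Fin.ext (Nat.add_right_comm _ _ _))
      · change top K (n + k) (β K • z) ⟨j + i, by omega⟩ = _
        rw [top_β_smul, top_β_smul])

@[simp]
theorem soc_window (k : ℕ) (i : Fin (k + 1)) (z : SNeg K (n + k)) (j : Fin n) :
    soc K n (window K n k i z) j = soc K (n + k) z ⟨j + i, by omega⟩ := rfl

@[simp]
theorem top_window (k : ℕ) (i : Fin (k + 1)) (z : SNeg K (n + k)) (j : Fin (n + 1)) :
    top K n (window K n k i z) j = top K (n + k) z ⟨j + i, by omega⟩ := rfl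

theorem window_window_zero (k : ℕ) (i : Fin (k + 1)) (z : SNeg K (n + k + 1)) :
    window K n k i (window K (n + k) 1 0 z) = window K n (k + 1) i.castSucc z := rfl

theorem window_window_one (k : ℕ) (i : Fin (k + 1)) (z : SNeg K (n + k + 1)) :
    window K n k i (window K (n + k) 1 1 z) = window K n (k + 1) i.succ z := rfl

theorem window_surjective (k : ℕ) (i : Fin (k + 1)) : Function.Surjective (window K n k i) := by
  intro z
  refine ⟨mk (fun j => if h : (i : ℕ) ≤ j ∧ (j : ℕ) - i < n then soc K n z ⟨j - i, h.2⟩ else 0)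
    (fun j => if h : (i : ℕ) ≤ j ∧ (j : ℕ) - i < n + 1 then top K n z ⟨j - i, h.2⟩ else 0), ?_⟩
  exact ext_coord (fun j => by simp) fun j => by simp [j.is_le.not_gt]

/-- The map `S_{-(n+k)}^{k+1} → S_{-n}` whose components are all the windows. -/
noncomputable def windowSum (K : Type*) [Field K] (n k : ℕ) :
    (Fin (k + 1) → SNeg K (n + k)) →ₗ[Lam K] SNeg K n :=
  ∑ i, window K n k i ∘ₗ LinearMap.proj i

theorem windowSum_apply (k : ℕ) (z : Fin (k + 1) → SNeg K (n + k)) :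
    windowSum K n k z = ∑ i, window K n k i (z i) := by
  simp [windowSum]

theorem windowSum_surjective (k : ℕ) : Function.Surjective (windowSum K n k) := by
  intro z
  obtain ⟨w, rfl⟩ := window_surjective k 0 z
  refine ⟨Pi.single 0 w, ?_⟩
  rw [windowSum_apply, Finset.sum_eq_single 0 (fun i _ hi => by simp [hi]) (by simp)]
  simp

/-- The map `S_{-(m+1)}^k → S_{-m}^{k+1}` that sends `w` to the tuple of the differences between
the upper window of `w i` and the lower window of `w (i - 1)`, where `w (-1) = w k = 0`. -/
noncomputable def windowDiff (K : Type*) [Field K] (m k : ℕ) :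
    (Fin k → SNeg K (m + 1)) →ₗ[Lam K] (Fin (k + 1) → SNeg K m) where
  toFun w := Fin.snoc (α := fun _ => SNeg K m) (fun i => window K m 1 1 (w i)) 0
    - Fin.cons (α := fun _ => SNeg K m) 0 (fun i => window K m 1 0 (w i))
  map_add' w w' := by
    ext1 i
    have h1 : Fin.snoc (α := fun _ => SNeg K m) (fun i => window K m 1 1 ((w + w') i)) 0 i =
        Fin.snoc (α := fun _ => SNeg K m) (fun i => window K m 1 1 (w i)) 0 i +
        Fin.snoc (α := fun _ => SNeg K m) (fun i => window K m 1 1 (w' i)) 0 i := by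
      refine Fin.lastCases ?_ (fun j => ?_) i <;> simp
    have h2 : Fin.cons (α := fun _ => SNeg K m) 0 (fun i => window K m 1 0 ((w + w') i)) i =
        Fin.cons (α := fun _ => SNeg K m) 0 (fun i => window K m 1 0 (w i)) i +
        Fin.cons (α := fun _ => SNeg K m) 0 (fun i => window K m 1 0 (w' i)) i := by
      refine Fin.cases ?_ (fun j => ?_) i <;> simp
    simp only [Pi.sub_apply, Pi.add_apply] at h1 h2 ⊢
    rw [h1, h2]
    abel
  map_smul' a w := by
    ext1 i
    have h1 : Fin.snoc (α := fun _ => SNeg K m) (fun i => window K m 1 1 ((a • w) i)) 0 i =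
        a • Fin.snoc (α := fun _ => SNeg K m) (fun i => window K m 1 1 (w i)) 0 i := by
      refine Fin.lastCases ?_ (fun j => ?_) i <;> simp
    have h2 : Fin.cons (α := fun _ => SNeg K m) 0 (fun i => window K m 1 0 ((a • w) i)) i =
        a • Fin.cons (α := fun _ => SNeg K m) 0 (fun i => window K m 1 0 (w i)) i := by
      refine Fin.cases ?_ (fun j => ?_) i <;> simp
    simp only [Pi.sub_apply, Pi.smul_apply, RingHom.id_apply, smul_sub] at h1 h2 ⊢
    rw [h1, h2]

theorem windowDiff_apply (m k : ℕ) (w : Fin k → SNeg K (m + 1)) :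
    windowDiff K m k w = Fin.snoc (α := fun _ => SNeg K m) (fun i => window K m 1 1 (w i)) 0
    - Fin.cons (α := fun _ => SNeg K m) 0 (fun i => window K m 1 0 (w i)) := rfl

theorem windowSum_windowDiff (k : ℕ) (w : Fin k → SNeg K (n + k + 1)) :
    windowSum K n k (windowDiff K (n + k) k w) = 0 := by
  simp only [windowSum_apply, windowDiff_apply, map_sub]
  rw [Fin.sum_univ_castSucc, Fin.sum_univ_succ, sub_eq_zero]
  simp only [Fin.snoc_castSucc, Fin.snoc_last, Fin.cons_zero, Fin.cons_succ, map_zero, add_zero,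
    zero_add]
  refine Finset.sum_congr rfl fun i _ => ext_coord (fun j => ?_) fun j => ?_
  · exact congrArg (soc K (n + k + 1) (w i)) (Fin.ext (by simp; omega))
  · exact congrArg (top K (n + k + 1) (w i)) (Fin.ext (by simp; omega))

/-- A family of `k` sequences of length greater than `k`, indexed from `0`, in which every
sequence is the shift of the next one, the first one vanishes beyond its first term and the last one
before its last term, is zero: a shift leads from each term to one of the vanishing ones. -/
theorem eq_zero_of_shift {k N : ℕ} (hN : k ≤ N) (w : Fin (k + 1) → Fin (N + 2) → K)
    (h0 : ∀ j : Fin (N + 1), w 0 j.succ = 0)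
    (h : ∀ (i : Fin k) (j : Fin (N + 1)), w i.succ j.succ = w i.castSucc j.castSucc)
    (h1 : ∀ j : Fin (N + 1), w (Fin.last k) j.castSucc = 0) : w = 0 := by
  have hgt : ∀ (i : Fin (k + 1)) (j : Fin (N + 2)), (i : ℕ) < j → w i j = 0 := by
    intro i
    induction i using Fin.induction with
    | zero =>
      intro j hj
      obtain ⟨j, rfl⟩ := Fin.exists_succ_eq_of_ne_zero (x := j) (by rintro rfl; simp at hj)
      exact h0 j
    | succ i ih =>
      intro j hj
      obtain ⟨j, rfl⟩ := Fin.exists_succ_eq_of_ne_zero (x := j) (by rintro rfl; simp at hj)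
      rw [h]
      exact ih _ (by simpa using hj)
  have hle : ∀ (i : Fin (k + 1)) (j : Fin (N + 2)), (j : ℕ) ≤ i → w i j = 0 := by
    intro i
    induction i using Fin.reverseInduction with
    | last =>
      intro j hj
      obtain ⟨j, rfl⟩ := Fin.exists_castSucc_eq (i := j).mpr
        (by rintro rfl; simp at hj; omega)
      exact h1 j
    | cast i ih =>
      intro j hj
      obtain ⟨j, rfl⟩ := Fin.exists_castSucc_eq (i := j).mpr
        (by rintro rfl; simp at hj; omega)
      rw [← h]
      exact ih _ (by simpa using hj)
  ext i j
  exact (lt_or_ge (i : ℕ) j).elim (hgt i j) (hle i j)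

theorem windowDiff_injective (k : ℕ) : Function.Injective (windowDiff K (n + k) k) := by
  rw [injective_iff_map_eq_zero]
  intro w hw
  cases k with
  | zero => exact Subsingleton.elim _ _
  | succ k =>
    have hw' : ∀ i, Fin.snoc (α := fun _ => SNeg K (n + (k + 1)))
          (fun i => window K (n + (k + 1)) 1 1 (w i)) 0 i =
        Fin.cons (α := fun _ => SNeg K (n + (k + 1))) 0
          (fun i => window K (n + (k + 1)) 1 0 (w i)) i :=
      fun i => sub_eq_zero.mp (congrFun hw i)
    have h0 : window K (n + (k + 1)) 1 1 (w 0) = 0 := by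
      have := hw' (Fin.castSucc 0)
      rwa [Fin.snoc_castSucc, Fin.castSucc_zero, Fin.cons_zero] at this
    have hl : window K (n + (k + 1)) 1 0 (w (Fin.last k)) = 0 := by
      have := hw' (Fin.last k).succ
      rwa [Fin.cons_succ, Fin.succ_last, Fin.snoc_last, eq_comm] at this
    have h : ∀ i : Fin k, window K (n + (k + 1)) 1 1 (w i.succ) =
        window K (n + (k + 1)) 1 0 (w i.castSucc) := fun i => by
      have := hw' i.castSucc.succ
      rwa [Fin.cons_succ, Fin.succ_castSucc, Fin.snoc_castSucc] at this
    have hs := eq_zero_of_shift (K := K) (k := k) (N := n + k) (by omega)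
      (fun i => soc K _ (w i))
      (fun j => congrFun (congrArg (soc K _) h0) j)
      (fun i j => congrFun (congrArg (soc K _) (h i)) j)
      (fun j => congrFun (congrArg (soc K _) hl) j)
    have ht := eq_zero_of_shift (K := K) (k := k) (N := n + k + 1) (by omega)
      (fun i => top K _ (w i))
      (fun j => congrFun (congrArg (top K _) h0) j)
      (fun i j => congrFun (congrArg (top K _) (h i)) j)
      (fun j => congrFun (congrArg (top K _) hl) j)
    ext1 i
    exact ext_coord (fun j => congrFun (congrFun hs i) j) fun j => congrFun (congrFun ht i) j

/-- Exactness in the middle follows by counting dimensions. -/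
theorem windowDiff_windowSum_exact (k : ℕ) :
    Function.Exact (windowDiff K (n + k) k) (windowSum K n k) := by
  let g := (windowDiff K (n + k) k).restrictScalars K
  let f := (windowSum K n k).restrictScalars K
  have hle : LinearMap.range g ≤ LinearMap.ker f := by
    rintro _ ⟨w, rfl⟩
    exact windowSum_windowDiff k w
  have hdim : Module.finrank K (LinearMap.range g) = Module.finrank K (LinearMap.ker f) := by
    have h1 := LinearMap.finrank_range_of_inj (f := g) (windowDiff_injective k)
    have h2 := LinearMap.finrank_range_add_finrank_ker f
    rw [LinearMap.range_eq_top.mpr (show Function.Surjective f from windowSum_surjective k),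
      finrank_top] at h2
    simp only [Module.finrank_pi_fintype, finrank_eq, Finset.sum_const, Finset.card_univ,
      Fintype.card_fin, smul_eq_mul] at h1 h2
    rw [h1]
    nlinarith
  exact (LinearMap.exact_iff (f := g) (g := f)).mpr (Submodule.eq_of_le_of_finrank_eq hle hdim).symm

/-! ### Split epimorphisms onto `S_{-n}` -/

/-- A Toeplitz matrix whose last column and first column vanish off the diagonal is scalar. -/
theorem toeplitz_eq (c : Fin (n + 1) → Fin (n + 1) → K)
    (h : ∀ i j : Fin n, c i.castSucc j.castSucc = c i.succ j.succ)
    (hl : ∀ i : Fin n, c i.castSucc (Fin.last n) = 0) (h0 : ∀ i : Fin n, c i.succ 0 = 0)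
    (i j : Fin (n + 1)) : c i j = if i = j then c (Fin.last n) (Fin.last n) else 0 := by
  have hgt : ∀ j i, j < i → c i j = 0 := by
    intro j
    induction j using Fin.induction with
    | zero =>
      intro i hi
      obtain ⟨i, rfl⟩ := Fin.exists_succ_eq_of_ne_zero hi.ne'
      exact h0 i
    | succ j ih =>
      intro i hi
      obtain ⟨i, rfl⟩ := Fin.exists_succ_eq_of_ne_zero (Fin.ne_zero_of_lt hi)
      rw [← h]
      exact ih _ (by simpa using hi)
  have hle : ∀ j i, i ≤ j → c i j = if i = j then c (Fin.last n) (Fin.last n) else 0 := by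
    intro j
    induction j using Fin.reverseInduction with
    | last =>
      intro i _
      refine Fin.lastCases (by simp) (fun i => ?_) i
      simp [hl, Fin.castSucc_ne_last]
    | cast j ih =>
      intro i hi
      obtain ⟨i, rfl⟩ := Fin.exists_castSucc_eq (i := i).mpr
        (ne_of_lt (hi.trans_lt (Fin.castSucc_lt_last j)))
      rw [h, ih _ (by simpa using hi)]
      simp
  rcases lt_or_ge j i with hij | hij
  · rw [hgt _ _ hij, if_neg hij.ne']
  · exact hle _ _ hij

section

variable {X : Type*} [AddCommGroup X] [Module (Lam K) X]

/-- The composite of a homomorphism `S_{-n} → X` with a homomorphism `X → S_{-n}` acts on the top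
and on the socle as one scalar, which can be read off from the last basis vector of the top; if it
is nonzero, the composite is bijective. -/
theorem bijective_comp_homOfTop [Module K X] [IsScalarTower K (Lam K) X]
    (φ : X →ₗ[Lam K] SNeg K n) (y : Fin (n + 1) → X)
    (h0 : β K • y 0 = 0) (h : ∀ j : Fin n, β K • y j.succ = α K • y j.castSucc)
    (h1 : α K • y (Fin.last n) = 0) (hy : top K n (φ (y (Fin.last n))) (Fin.last n) ≠ 0) :
    Function.Bijective (φ ∘ₗ homOfTop y h0 h h1) := by
  have hc := toeplitz_eq (fun i j => top K n (φ (y j)) i)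
    (fun i j => by
      rw [← soc_α_smul, ← soc_β_smul, ← map_smul, ← map_smul, h])
    (fun i => by rw [← soc_α_smul, ← map_smul, h1]; simp)
    (fun i => by rw [← soc_β_smul, ← map_smul, h0]; simp)
  set c := top K n (φ (y (Fin.last n))) (Fin.last n)
  have hsmul : ∀ (a : K) x, φ (a • x) = a • φ x := fun a x =>
    (φ.restrictScalars K).map_smul a x
  have htop : ∀ z i, top K n (φ (homOfTop y h0 h h1 z)) i = top K n z i * c := by
    intro z i
    simp [homOfTop_apply, hsmul, hc]
  have hsoc : ∀ z, top K n z = 0 → ∀ i,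
      soc K n (φ (homOfTop y h0 h h1 z)) i = soc K n z i * c := by
    intro z hz i
    simp [homOfTop_apply, hsmul, hc, hz]
  have hinj : Function.Injective (φ ∘ₗ homOfTop y h0 h h1) := by
    rw [injective_iff_map_eq_zero]
    intro z hz
    have hz' : φ (homOfTop y h0 h h1 z) = 0 := hz
    have ht : top K n z = 0 := by
      ext i
      have := htop z i
      rw [hz', map_zero, Pi.zero_apply, eq_comm, mul_eq_zero] at this
      exact this.resolve_right hy
    refine ext_coord (fun i => ?_) (fun i => by rw [ht, map_zero])
    have := hsoc z ht i
    rw [hz', map_zero, Pi.zero_apply, eq_comm, mul_eq_zero] at this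
    rw [this.resolve_right hy, map_zero, Pi.zero_apply]
  exact ⟨hinj, (LinearMap.injective_iff_surjective
    (f := (φ ∘ₗ homOfTop y h0 h h1).restrictScalars K)).mp hinj⟩

end

/-- A homomorphism from an indecomposable module that has a right inverse up to an
automorphism is bijective. -/
theorem _root_.IsIndecomposableModule.bijective_of_comp {R M N : Type*} [Ring R] [AddCommGroup M]
    [Module R M] [AddCommGroup N] [Module R N] [Nontrivial N] (hM : IsIndecomposableModule R M)
    (φ : M →ₗ[R] N) (σ : N →ₗ[R] M) (h : Function.Bijective (φ ∘ₗ σ)) :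
    Function.Bijective φ := by
  have hcompl : IsCompl (LinearMap.ker φ) (LinearMap.range σ) := by
    constructor
    · rw [Submodule.disjoint_def]
      rintro _ hx ⟨z, rfl⟩
      have : z = 0 := h.1 (by simpa using hx)
      rw [this, map_zero]
    · rw [codisjoint_iff, eq_top_iff]
      intro x _
      obtain ⟨z, hz⟩ := h.2 (φ x)
      rw [← sub_add_cancel x (σ z)]
      refine Submodule.add_mem_sup ?_ ⟨z, rfl⟩
      rw [LinearMap.mem_ker, map_sub, sub_eq_zero, ← hz, LinearMap.comp_apply]
  refine ⟨?_, Function.Surjective.of_comp (g := σ) h.2⟩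
  rcases hM.2 _ _ hcompl with h' | h'
  · exact LinearMap.ker_eq_bot.mp h'
  · obtain ⟨z, hz⟩ := exists_ne (0 : N)
    have : σ z = 0 := by
      rw [← Submodule.mem_bot R, ← h']
      exact ⟨z, rfl⟩
    exact absurd (h.1 (by simp [this])) hz

/-! ### Factorization -/

section

variable {X : Type*} [AddCommGroup X] [Module (Lam K) X]

/-- The transpose of the linear system that a decomposition of a homomorphism `X → S_{-n}`
into two windows has to satisfy: `y ↦ (β y₀, β y₁ - α y₀, …, β yₙ - α y_{n-1}, -α yₙ)`. Its kernel
is `Hom(S_{-n}, X)`. -/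
noncomputable def pencil (n : ℕ) [Module K X] [IsScalarTower K (Lam K) X] :
    (Fin (n + 1) → X) →ₗ[K] (Fin (n + 2) → X) :=
  LinearMap.lsum K (fun _ => X) K fun i =>
    LinearMap.single K (fun _ => X) i.castSucc ∘ₗ Algebra.lsmul K K X (β K)
      - LinearMap.single K (fun _ => X) i.succ ∘ₗ Algebra.lsmul K K X (α K)

section

variable [Module K X] [IsScalarTower K (Lam K) X]

theorem pencil_apply (y : Fin (n + 1) → X) : pencil (K := K) n y =
    ∑ i, (Pi.single i.castSucc (β K • y i) - Pi.single i.succ (α K • y i)) := by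
  simp [pencil, LinearMap.lsum_apply]

theorem pencil_single (i : Fin (n + 1)) (x : X) : pencil (K := K) n (Pi.single i x) =
    Pi.single i.castSucc (β K • x) - Pi.single i.succ (α K • x) := by
  rw [pencil_apply, Finset.sum_eq_single i (fun j _ hj => by simp [hj]) (by simp)]
  simp

theorem pencil_zero (y : Fin (n + 1) → X) : pencil (K := K) n y 0 = β K • y 0 := by
  rw [pencil_apply, Fin.sum_univ_succ]
  simp [Finset.sum_apply, Fin.succ_ne_zero]

theorem pencil_last (y : Fin (n + 1) → X) :
    pencil (K := K) n y (Fin.last _) = -(α K • y (Fin.last _)) := by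
  rw [pencil_apply, Fin.sum_univ_castSucc]
  simp [Finset.sum_apply]

theorem pencil_succ_castSucc (y : Fin (n + 1) → X) (j : Fin n) :
    pencil (K := K) n y j.succ.castSucc = β K • y j.succ - α K • y j.castSucc := by
  rw [pencil_apply, Finset.sum_sub_distrib, Pi.sub_apply, Finset.sum_apply, Finset.sum_apply]
  congr 1
  · rw [Finset.sum_eq_single j.succ]
    · simp
    · intro i _ hi
      rw [Pi.single_eq_of_ne]
      exact fun h => hi (Fin.castSucc_injective _ h).symm
    · simp
  · rw [Finset.sum_eq_single j.castSucc]
    · simp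
    · intro i _ hi
      rw [← Fin.succ_castSucc, Pi.single_eq_of_ne]
      simpa using hi.symm
    · simp

/-- By linear duality, a homomorphism `φ : X → S_{-(n+1)}` is a sum of the two windows of
homomorphisms into `S_{-(n+2)}` unless some homomorphism `S_{-(n+1)} → X`, given by `y`,
has a composite with `φ` that is nonzero on the top. -/
theorem exists_window_add_window (φ : X →ₗ[Lam K] SNeg K (n + 1))
    (hφ : ∀ y : Fin (n + 2) → X, pencil (K := K) (n + 1) y = 0 →
      top K (n + 1) (φ (y (Fin.last _))) (Fin.last _) = 0) :
    ∃ η ζ : X →ₗ[Lam K] SNeg K (n + 2),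
      φ = window K (n + 1) 1 0 ∘ₗ η + window K (n + 1) 1 1 ∘ₗ ζ := by
  -- The functional `y ↦ φ_{n+1}(y_{n+1})` vanishes on the kernel of `pencil`,
  -- hence factors through it.
  let r : (Fin (n + 2) → X) →ₗ[K] K :=
    LinearMap.proj (Fin.last _) ∘ₗ top K (n + 1) ∘ₗ φ.restrictScalars K ∘ₗ
      LinearMap.proj (Fin.last _)
  have hr : r ∈ LinearMap.range (pencil (K := K) (X := X) (n + 1)).dualMap := by
    rw [LinearMap.range_dualMap_eq_dualAnnihilator_ker, Submodule.mem_dualAnnihilator]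
    exact fun y hy => hφ y hy
  obtain ⟨s, hs⟩ := hr
  let t : Fin (n + 3) → X →ₗ[K] K := fun i => s ∘ₗ LinearMap.single K (fun _ => X) i
  have key : ∀ (i : Fin (n + 2)) x,
      t i.castSucc (β K • x) - t i.succ (α K • x) = r (Pi.single i x) := by
    intro i x
    rw [← hs, LinearMap.dualMap_apply, pencil_single, map_sub]
    rfl
  have key1 : ∀ (i : Fin (n + 1)) x,
      t i.castSucc.castSucc (β K • x) = t i.castSucc.succ (α K • x) := by
    intro i x
    rw [← sub_eq_zero, key]
    simp [r]
  have key2 : ∀ x, t (Fin.last _).castSucc (β K • x) - t (Fin.last _).succ (α K • x) =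
      top K (n + 1) (φ x) (Fin.last _) := by
    intro x
    rw [key]
    simp [r]
  let ξ : Fin (n + 1) → X →ₗ[K] K := fun i =>
    LinearMap.proj i ∘ₗ soc K (n + 1) ∘ₗ φ.restrictScalars K
  have hξα : ∀ i x, ξ i (α K • x) = top K (n + 1) (φ x) i.castSucc := by
    intro i x; simp [ξ]
  have hξβ : ∀ i x, ξ i (β K • x) = top K (n + 1) (φ x) i.succ := by
    intro i x; simp [ξ]
  let e : Fin (n + 2) → X →ₗ[K] K := Fin.snoc (α := fun _ => X →ₗ[K] K)
    (fun i => ξ i - t i.succ.castSucc) (-t (Fin.last _))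
  have he : ∀ (j : Fin (n + 1)) x, e j.castSucc (β K • x) = e j.succ (α K • x) := by
    intro j x
    refine Fin.lastCases ?_ (fun i => ?_) j
    · have := key2 x
      simp only [e, Fin.snoc_castSucc, Fin.succ_last, Fin.snoc_last, LinearMap.sub_apply,
        LinearMap.neg_apply, hξβ] at this ⊢
      linear_combination -this
    · have := key1 i.succ x
      simp only [e, Fin.snoc_castSucc, Fin.succ_castSucc, LinearMap.sub_apply, hξβ, hξα] at this ⊢
      rw [this]
  refine ⟨homOfChain e he, homOfChain (fun i => t i.castSucc) key1, hom_ext fun i x => ?_⟩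
  have h1 : e i.castSucc x = ξ i x - t i.succ.castSucc x := by simp [e]
  change ξ i x = e i.castSucc x + t i.succ.castSucc x
  rw [h1, sub_add_cancel]

end

instance : Nontrivial (SNeg K n) :=
  inferInstanceAs (Nontrivial ((Fin n → K) × (Fin (n + 1) → K)))

/-- The two windows form a right almost split map `S_{-(n+2)}² → S_{-(n+1)}`. -/
theorem exists_window_add_window_of_isEmpty (hX : IsIndecomposableModule (Lam K) X)
    (hX' : IsEmpty (X ≃ₗ[Lam K] SNeg K (n + 1))) (φ : X →ₗ[Lam K] SNeg K (n + 1)) :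
    ∃ η ζ : X →ₗ[Lam K] SNeg K (n + 2),
      φ = window K (n + 1) 1 0 ∘ₗ η + window K (n + 1) 1 1 ∘ₗ ζ := by
  let _ : Module K X := Module.compHom X (algebraMap K (Lam K))
  have : IsScalarTower K (Lam K) X := .of_algebraMap_smul fun _ _ => rfl
  refine exists_window_add_window φ fun y hy => by_contra fun hne => ?_
  have h0 : β K • y 0 = 0 := by rw [← pencil_zero, hy, Pi.zero_apply]
  have h1 : α K • y (Fin.last _) = 0 := by
    rw [← neg_eq_zero, ← pencil_last, hy, Pi.zero_apply]
  have h : ∀ j : Fin (n + 1), β K • y j.succ = α K • y j.castSucc := fun j => by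
    rw [← sub_eq_zero, ← pencil_succ_castSucc, hy, Pi.zero_apply]
  exact hX'.false (LinearEquiv.ofBijective φ
    (hX.bijective_of_comp φ _ (bijective_comp_homOfTop φ y h0 h h1 hne)))

/-- Induction on `k`: each component of a factorization through `S_{-(n+k)}^{k+1}` splits further
into two windows. -/
theorem exists_windowSum_comp_eq (hn : 0 < n) (k : ℕ) (hX : IsIndecomposableModule (Lam K) X)
    (hX' : ∀ i : ℕ, i < k → IsEmpty (X ≃ₗ[Lam K] SNeg K (n + i)))
    (φ : X →ₗ[Lam K] SNeg K n) :
    ∃ ψ : X →ₗ[Lam K] (Fin (k + 1) → SNeg K (n + k)), windowSum K n k ∘ₗ ψ = φ := by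
  induction k with
  | zero =>
    refine ⟨LinearMap.pi fun _ => φ, LinearMap.ext fun x => ?_⟩
    rw [LinearMap.comp_apply, windowSum_apply, Fin.sum_univ_one]
    rfl
  | succ k ih =>
    obtain ⟨ψ, rfl⟩ := ih fun i hi => hX' i (hi.trans k.lt_succ_self)
    obtain ⟨m, rfl⟩ : ∃ m, n = m + 1 := ⟨n - 1, by omega⟩
    have hstep : ∀ χ : X →ₗ[Lam K] SNeg K (m + 1 + k),
        ∃ η ζ : X →ₗ[Lam K] SNeg K (m + 1 + k + 1),
          χ = window K (m + 1 + k) 1 0 ∘ₗ η + window K (m + 1 + k) 1 1 ∘ₗ ζ := by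
      have hk := hX' k k.lt_succ_self
      generalize hl : m + 1 + k = l at hk ⊢
      obtain ⟨l, rfl⟩ : ∃ l', l = l' + 1 := ⟨m + k, by omega⟩
      exact exists_window_add_window_of_isEmpty hX hk
    choose η ζ hηζ using fun i => hstep (LinearMap.proj i ∘ₗ ψ)
    refine ⟨LinearMap.pi fun i =>
      Fin.snoc (α := fun _ => X →ₗ[Lam K] SNeg K (m + 1 + k + 1)) η 0 i +
      Fin.cons (α := fun _ => X →ₗ[Lam K] SNeg K (m + 1 + k + 1)) 0 ζ i, LinearMap.ext fun x => ?_⟩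
    have hx : ∀ i, ψ x i =
        window K (m + 1 + k) 1 0 (η i x) + window K (m + 1 + k) 1 1 (ζ i x) :=
      fun i => LinearMap.congr_fun (hηζ i) x
    simp only [LinearMap.comp_apply, windowSum_apply, LinearMap.pi_apply, LinearMap.add_apply,
      map_add, hx, Finset.sum_add_distrib, window_window_zero, window_window_one]
    congr 1
    · rw [Fin.sum_univ_castSucc]
      simp
    · rw [Fin.sum_univ_succ]
      simp

end

end SNeg

theorem mainTheorem5 {K : Type*} [Field K] [IsAlgClosed K] (n k : ℕ) (hn : 0 < n) (hk : 0 < k) :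
    ∃ (g : (Fin k → SNeg K (n + k + 1)) →ₗ[Lam K] (Fin (k + 1) → SNeg K (n + k)))
      (f : (Fin (k + 1) → SNeg K (n + k)) →ₗ[Lam K] SNeg K n),
      Function.Injective g ∧ Function.Exact g f ∧ Function.Surjective f ∧
      ∀ (X : Type*) [AddCommGroup X] [Module (Lam K) X] [Module.Finite (Lam K) X],
        IsIndecomposableModule (Lam K) X →
        (∀ i : ℕ, i < k → IsEmpty (X ≃ₗ[Lam K] SNeg K (n + i))) →
        ∀ φ : X →ₗ[Lam K] SNeg K n,
          ∃ ψ : X →ₗ[Lam K] (Fin (k + 1) → SNeg K (n + k)), f ∘ₗ ψ = φ :=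
  ⟨SNeg.windowDiff K (n + k) k, SNeg.windowSum K n k, SNeg.windowDiff_injective k,
    SNeg.windowDiff_windowSum_exact k, SNeg.windowSum_surjective k,
    fun _ _ _ _ hX hX' φ => SNeg.exists_windowSum_comp_eq hn k hX hX' φ⟩
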